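/- All matrices are real $d\times d$, $d\ge 1$. A matrix is \emph{Metzler} if its off-diagonal entries are nonnegative; its \emph{spectral abscissa} $\eta(A)$ is the largest real part of its complex eigenvalues, and a \emph{leading eigenvector} of a Metzler matrix $A$ is a vector $v\neq 0$, $v\ge 0$, with $Av=\eta(A)v$. Let $E$ be the all-ones matrix. The \emph{selected leading eigenvector} of a Metzler matrix $A$ is $\lim_{\varepsilon\to 0+}v_\varepsilon$, where $v_\varepsilon$ is the leading eigenvector of $A+\varepsilon E$ of Euclidean norm one. Let $\mathcal F_1,\dots,\mathcal F_d\subset\mathbb R^d$ be compact sets such that $a_j\ge 0$ for all $a\in\mathcal F_i$ and $j\ne i$, and let $\mathcal F$ be the product family of all (Metzler) matrices whose $i$-th row lies in $\mathcal F_i$ for every $i$. The \emph{selective greedy method} for maximizing $\eta$ over $\mathcal F$ starts with an arbitrary $A_1\in\mathcal F$. In the $k$-th iteration it takes the selected leading eigenvector $v_k$ of $A_k$ and, for each $i$, an arbitrary point $\hat A^{(i)}$ of maximum of $a\mapsto\langle a,v_k\rangle$ on $\mathcal F_i$; the $i$-th row of $A_{k+1}$ is the $i$-th row $A_k^{(i)}$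 of $A_k$ if $\langle\hat A^{(i)},v_k\rangle=\langle A_k^{(i)},v_k\rangle$, and is $\hat A^{(i)}$ if $\langle\hat A^{(i)},v_k\rangle>\langle A_k^{(i)},v_k\rangle$. The method terminates when $A_{k+1}=A_k$. The method for minimizing $\eta$ is the same with minimum in place of maximum and the last inequality reversed. \textbf{Theorem.} Every Metzler matrix has a unique selected leading eigenvector (the limit exists), and it is a leading eigenvector of that matrix. For every product family of Metzler matrices, with no positivity or irreducibility assumption, the selective greedy method, for maximization as well as for minimization, does not cycle: as long as it has not terminated, no matrix occurs twice. That is, if $A_{j+1}\neq A_j$ for all $1\le j\le N$, then $A_1,\dots,A_{N+1}$ are pairwise distinct. -/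

import Mathlib

open Filter Topology Matrix

noncomputable section

namespace SelectiveGreedy

variable {d : ℕ}

/-- A Metzler matrix: all off-diagonal entries are nonnegative. -/
def IsMetzler (A : Matrix (Fin d) (Fin d) ℝ) : Prop :=
  ∀ i j, j ≠ i → 0 ≤ A i j

/-- The set of vectors that can be the `i`-th row of a Metzler matrix. -/
def metzlerRows (i : Fin d) : Set (Fin d → ℝ) :=
  {a | ∀ j, j ≠ i → 0 ≤ a j}

/-- The set of all matrices whose `i`-th row belongs to `F i`, for every `i`. -/
def productFamily (F : Fin d → Set (Fin d → ℝ)) : Set (Matrix (Fin d) (Fin d) ℝ) :=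
  {A | ∀ i, A i ∈ F i}

/-- The uncertainty sets `F i` define a product family of Metzler matrices: they are compact and
consist of admissible rows. -/
structure IsMetzlerProductFamily (F : Fin d → Set (Fin d → ℝ)) : Prop where
  isCompact : ∀ i, IsCompact (F i)
  subset_metzlerRows : ∀ i, F i ⊆ metzlerRows i

/-- The spectral abscissa: the largest real part of the (complex) eigenvalues. -/
def spectralAbscissa (A : Matrix (Fin d) (Fin d) ℝ) : ℝ :=
  sSup (Complex.re '' spectrum ℂ (A.map (fun x : ℝ => (x : ℂ))))

/-- A leading (Perron) eigenvector: a nonzero nonnegative eigenvector for the leading eigenvalue,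
which for a Metzler matrix is the spectral abscissa. -/
structure IsLeadingEigenvector (A : Matrix (Fin d) (Fin d) ℝ) (v : Fin d → ℝ) : Prop where
  ne_zero : v ≠ 0
  nonneg : ∀ i, 0 ≤ v i
  mulVec_eq : A *ᵥ v = spectralAbscissa A • v

/-- The all-ones matrix `E`. -/
def allOnes (d : ℕ) : Matrix (Fin d) (Fin d) ℝ :=
  Matrix.of fun _ _ => 1

/-- `v` is the selected leading eigenvector of `A`: the limit, as `ε` tends to `0` from the right,
of the leading eigenvectors of `A + ε E` that have Euclidean norm one. -/
def IsSelectedLeadingEigenvector (A : Matrix (Fin d) (Fin d) ℝ) (v : Fin d → ℝ) : Prop :=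
  ∃ w : ℝ → Fin d → ℝ,
    (∀ ε : ℝ, 0 < ε →
      IsLeadingEigenvector (A + ε • allOnes d) (w ε) ∧ ‖WithLp.toLp 2 (w ε)‖ = 1) ∧
    Tendsto w (𝓝[>] 0) (𝓝 v)

/-- One iteration of the greedy method for maximization, from `A` to `A'`, with the leading
eigenvector `v` of `A`: for each `i` some maximizer `B i` of `a ↦ ⟨a, v⟩` on `F i` is found, and the
`i`-th row is replaced by `B i` only if this makes `⟨·, v⟩` strictly larger. -/
def MaxStep (F : Fin d → Set (Fin d → ℝ)) (v : Fin d → ℝ)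
    (A A' : Matrix (Fin d) (Fin d) ℝ) : Prop :=
  ∃ B : Matrix (Fin d) (Fin d) ℝ, ∀ i,
    (B i ∈ F i ∧ ∀ a ∈ F i, a ⬝ᵥ v ≤ B i ⬝ᵥ v) ∧
    (B i ⬝ᵥ v = A i ⬝ᵥ v → A' i = A i) ∧
    (A i ⬝ᵥ v < B i ⬝ᵥ v → A' i = B i)

/-- One iteration of the greedy method for minimization. -/
def MinStep (F : Fin d → Set (Fin d → ℝ)) (v : Fin d → ℝ)
    (A A' : Matrix (Fin d) (Fin d) ℝ) : Prop :=
  ∃ B : Matrix (Fin d) (Fin d) ℝ, ∀ i,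
    (B i ∈ F i ∧ ∀ a ∈ F i, B i ⬝ᵥ v ≤ a ⬝ᵥ v) ∧
    (B i ⬝ᵥ v = A i ⬝ᵥ v → A' i = A i) ∧
    (B i ⬝ᵥ v < A i ⬝ᵥ v → A' i = B i)

/-- The first `N` iterations of the selective greedy method for maximization on the product family
with uncertainty sets `F`, none of which is the terminating one. The method starts with an arbitrary
`A 0` in the family, takes at every iteration `k` the selected leading eigenvector `v k` of `A k`,
passes from `A k` to `A (k + 1)`, and terminates as soon as `A (k + 1) = A k`. -/
structure IsSelectiveGreedyMaxRun (F : Fin d → Set (Fin d → ℝ)) (N : ℕ)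
    (A : ℕ → Matrix (Fin d) (Fin d) ℝ) (v : ℕ → Fin d → ℝ) : Prop where
  start : A 0 ∈ productFamily F
  selected : ∀ k < N, IsSelectedLeadingEigenvector (A k) (v k)
  step : ∀ k < N, MaxStep F (v k) (A k) (A (k + 1))
  not_terminated : ∀ k < N, A (k + 1) ≠ A k

/-- The first `N` iterations of the selective greedy method for minimization, none of which is the
terminating one. -/
structure IsSelectiveGreedyMinRun (F : Fin d → Set (Fin d → ℝ)) (N : ℕ)
    (A : ℕ → Matrix (Fin d) (Fin d) ℝ) (v : ℕ → Fin d → ℝ) : Prop where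
  start : A 0 ∈ productFamily F
  selected : ∀ k < N, IsSelectedLeadingEigenvector (A k) (v k)
  step : ∀ k < N, MinStep F (v k) (A k) (A (k + 1))
  not_terminated : ∀ k < N, A (k + 1) ≠ A k

end SelectiveGreedy

end

noncomputable section

namespace SelectiveGreedy

variable {d : ℕ}

/-! The abscissa of the iterates themselves may stall, but that of their perturbations `A k + ε E`
is strictly monotone for all small `ε > 0`. A row changes only if it is strictly better for the
selected vector `v`; strictness is an open condition, so the row is also better for the perturbed
eigenvectors `w ε → v`, which are positive. Perron comparison (`lt_of_le_mulVec`, `gt_of_mulVec_le`)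
then orders the two perturbed abscissas strictly. Finitely many steps share one `ε`, so no matrix
returns.

For existence of the limit, put `t = η(A + ε E)`: the eigenvector equation reads `(t - A) w = ε (∑
w) 1`, so `w` is proportional to `(t - A)⁻¹ 1`. Up to a scalar this is a polynomial vector in `t`
that does not vanish at `a = lim t` (`exists_polynomial_resolvent`), hence its normalization
converges. -/

/-! ### Comparison of eigenvalues for positive off-diagonal entries -/

/-- A matrix with strictly positive off-diagonal entries. -/
def IsOffDiagPos (B : Matrix (Fin d) (Fin d) ℝ) : Prop :=
  ∀ i j, j ≠ i → 0 < B i j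

theorem IsMetzler.isOffDiagPos_add_smul_allOnes {A : Matrix (Fin d) (Fin d) ℝ} (hA : IsMetzler A)
    {ε : ℝ} (hε : 0 < ε) : IsOffDiagPos (A + ε • allOnes d) := by
  intro i j hij
  have := hA i j hij
  simp only [Matrix.add_apply, Matrix.smul_apply, allOnes, Matrix.of_apply, smul_eq_mul]
  linarith

theorem IsOffDiagPos.isMetzler {B : Matrix (Fin d) (Fin d) ℝ} (hB : IsOffDiagPos B) :
    IsMetzler B := fun i j h => (hB i j h).le

theorem add_smul_allOnes_mulVec (A : Matrix (Fin d) (Fin d) ℝ) (ε : ℝ) (x : Fin d → ℝ)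
    (i : Fin d) : ((A + ε • allOnes d) *ᵥ x) i = (A *ᵥ x) i + ε * ∑ j, x j := by
  simp [allOnes, Matrix.mulVec, dotProduct, add_mul, Finset.sum_add_distrib, Finset.mul_sum]

/-- A nonnegative vector is zero if a matrix with positive off-diagonal entries maps it to a vector
that is nonpositive at some zero coordinate of it. -/
theorem IsOffDiagPos.eq_zero {B : Matrix (Fin d) (Fin d) ℝ} (hB : IsOffDiagPos B)
    {y : Fin d → ℝ} (hy : ∀ i, 0 ≤ y i) {i : Fin d} (hi : y i = 0) (hBy : (B *ᵥ y) i ≤ 0) :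
    y = 0 := by
  have hnn : ∀ j ∈ Finset.univ, 0 ≤ B i j * y j := by
    intro j _
    by_cases hj : j = i
    · simp [hj, hi]
    · exact mul_nonneg (hB i j hj).le (hy j)
  have hsum : ∑ j, B i j * y j = 0 := le_antisymm hBy (Finset.sum_nonneg hnn)
  funext j
  by_cases hj : j = i
  · simp [hj, hi]
  · have := (Finset.sum_eq_zero_iff_of_nonneg hnn).1 hsum j (Finset.mem_univ j)
    exact (mul_eq_zero.1 this).resolve_left (hB i j hj).ne'

theorem IsOffDiagPos.pos_of_mulVec_eq {B : Matrix (Fin d) (Fin d) ℝ} (hB : IsOffDiagPos B)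
    {x : Fin d → ℝ} {t : ℝ} (hx : ∀ i, 0 ≤ x i) (hx0 : x ≠ 0) (h : B *ᵥ x = t • x) (i : Fin d) :
    0 < x i := by
  refine lt_of_le_of_ne (hx i) fun hi => hx0 (hB.eq_zero hx hi.symm ?_)
  simp [h, ← hi]

/-- Scaling a positive vector to touch another one from above. -/
theorem exists_touching [NeZero d] {x y : Fin d → ℝ} (hx : ∀ i, 0 ≤ x i) (hy : ∀ i, 0 < y i) :
    ∃ s : ℝ, 0 ≤ s ∧ (∀ i, x i ≤ s * y i) ∧ ∃ i, x i = s * y i := by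
  obtain ⟨i, -, hi⟩ := Finset.exists_max_image Finset.univ (fun i => x i / y i)
    Finset.univ_nonempty
  refine ⟨x i / y i, div_nonneg (hx i) (hy i).le, fun j => ?_, i, ?_⟩
  · exact (div_le_iff₀ (hy j)).1 (hi j (Finset.mem_univ j))
  · rw [div_mul_cancel₀ _ (hy i).ne']

/-- If `t ≤ r`, scale `y` to touch `x` from above at `k`. Then `B (s y - x)` is nonpositive at `k`,
so `x = s y`, against the strict inequality. -/
theorem IsOffDiagPos.lt_of_le_mulVec [NeZero d] {B : Matrix (Fin d) (Fin d) ℝ}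
    (hB : IsOffDiagPos B) {x y : Fin d → ℝ} {r t : ℝ} (hx : ∀ i, 0 < x i) (hy : ∀ i, 0 < y i)
    (hBy : B *ᵥ y = t • y) (h : ∀ i, r * x i ≤ (B *ᵥ x) i) {i : Fin d}
    (hi : r * x i < (B *ᵥ x) i) : r < t := by
  by_contra! htr
  obtain ⟨s, -, hs, k, hk⟩ := exists_touching (fun i => (hx i).le) hy
  have hz : s • y - x = 0 := by
    refine hB.eq_zero (i := k) (fun j => ?_) ?_ ?_
    · simpa using hs j
    · simp [hk]
    · have h1 := h k
      have h2 := mul_le_mul_of_nonneg_right htr (hx k).le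
      simp only [Matrix.mulVec_sub, Matrix.mulVec_smul, hBy, Pi.sub_apply, Pi.smul_apply,
        smul_eq_mul]
      have h3 : s * (t * y k) = t * x k := by rw [hk]; ring
      linarith
  have hxy : x = s • y := (sub_eq_zero.1 hz).symm
  have h3 : (B *ᵥ x) i = t * x i := by
    rw [hxy, Matrix.mulVec_smul, hBy]
    simp only [Pi.smul_apply, smul_eq_mul]
    ring
  have h2 := mul_le_mul_of_nonneg_right htr (hx i).le
  linarith

/-- The mirror argument: here `x` is scaled to touch `y` from above. -/
theorem IsOffDiagPos.gt_of_mulVec_le [NeZero d] {B : Matrix (Fin d) (Fin d) ℝ}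
    (hB : IsOffDiagPos B) {x y : Fin d → ℝ} {r t : ℝ} (hx : ∀ i, 0 < x i) (hy : ∀ i, 0 < y i)
    (hBy : B *ᵥ y = t • y) (h : ∀ i, (B *ᵥ x) i ≤ r * x i) {i : Fin d}
    (hi : (B *ᵥ x) i < r * x i) : t < r := by
  by_contra! htr
  obtain ⟨s, hs0, hs, k, hk⟩ := exists_touching (fun i => (hy i).le) hx
  have hz : s • x - y = 0 := by
    refine hB.eq_zero (i := k) (fun j => ?_) ?_ ?_
    · simpa using hs j
    · simp [hk]
    · have h1 := mul_le_mul_of_nonneg_left (h k) hs0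
      have h2 := mul_le_mul_of_nonneg_right htr (hy k).le
      simp only [Matrix.mulVec_sub, Matrix.mulVec_smul, hBy, Pi.sub_apply, Pi.smul_apply,
        smul_eq_mul]
      have h3 : s * (r * x k) = r * y k := by rw [hk]; ring
      linarith
  have hxy : y = s • x := (sub_eq_zero.1 hz).symm
  have hspos : 0 < s := by
    refine lt_of_le_of_ne hs0 fun h0 => (hy k).ne' ?_
    rw [hk, ← h0, zero_mul]
  have h3 : s * (B *ᵥ x) i = s * (t * x i) := by
    have := congrFun hBy i
    rw [hxy, Matrix.mulVec_smul] at this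
    simp only [Pi.smul_apply, smul_eq_mul] at this
    linarith
  have h4 := mul_left_cancel₀ hspos.ne' h3
  have h2 := mul_le_mul_of_nonneg_right htr (hx i).le
  linarith

/-! ### Existence of Perron eigenvectors -/

/-- Perron's theorem for entrywise positive matrices: existence of a positive eigenvector. -/
theorem exists_pos_eigenvector_of_pos [NeZero d] {M : Matrix (Fin d) (Fin d) ℝ}
    (hM : ∀ i j, 0 < M i j) : ∃ (r : ℝ) (x : Fin d → ℝ), (∀ i, 0 < x i) ∧ M *ᵥ x = r • x := by
  have hpos : ∀ x : Fin d → ℝ, (∀ i, 0 ≤ x i) → x ≠ 0 → ∀ i, 0 < (M *ᵥ x) i := by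
    intro x hx hx0 i
    obtain ⟨j, hj⟩ := Function.ne_iff.1 hx0
    exact Finset.sum_pos' (fun k _ => mul_nonneg (hM i k).le (hx k))
      ⟨j, Finset.mem_univ j, mul_pos (hM i j) (lt_of_le_of_ne (hx j) (Ne.symm hj))⟩
  have hsimp : ∀ x ∈ stdSimplex ℝ (Fin d), ∀ i, 0 < (M *ᵥ x) i := by
    intro x hx
    refine hpos x hx.1 ?_
    rintro rfl
    simpa using hx.2
  -- The Collatz–Wielandt quotient is taken at `M x` instead of `x`: the denominators stay positive
  -- on the boundary of the simplex, so `f` is continuous there.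
  let f : (Fin d → ℝ) → ℝ := fun x =>
    Finset.univ.inf' Finset.univ_nonempty fun i => (M *ᵥ (M *ᵥ x)) i / (M *ᵥ x) i
  have hc : Continuous fun x : Fin d → ℝ => M *ᵥ x := Continuous.matrix_mulVec continuous_const
    continuous_id
  have hf : ContinuousOn f (stdSimplex ℝ (Fin d)) := by
    refine ContinuousOn.finset_inf'_apply _ fun i _ => ?_
    refine ContinuousOn.div ?_ ?_ fun x hx => (hsimp x hx i).ne'
    · exact ((continuous_apply i).comp (hc.comp hc)).continuousOn
    · exact ((continuous_apply i).comp hc).continuousOn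
  obtain ⟨x, hx, hmax⟩ := (isCompact_stdSimplex ℝ (Fin d)).exists_isMaxOn
    ⟨_, single_mem_stdSimplex ℝ (0 : Fin d)⟩ hf
  set u := M *ᵥ x with hu
  have hupos : ∀ i, 0 < u i := hsimp x hx
  refine ⟨f x, u, hupos, ?_⟩
  have hle : ∀ i, 0 ≤ (M *ᵥ u - f x • u) i := by
    intro i
    have : f x ≤ (M *ᵥ u) i / u i := Finset.inf'_le _ (Finset.mem_univ i)
    have := (le_div_iff₀ (hupos i)).1 this
    simpa using this
  by_contra hne
  -- A nonzero nonnegative defect becomes strictly positive under `M`, so the normalized `u` would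
  -- beat the maximizer `x`.
  have hstrict := hpos _ hle (sub_ne_zero.2 hne)
  have hMu : ∀ i, 0 < (M *ᵥ u) i := hpos u (fun i => (hupos i).le) fun h0 => by
    have := hupos 0
    simp [h0] at this
  have hσ : 0 < ∑ i, u i := Finset.sum_pos (fun i _ => hupos i) Finset.univ_nonempty
  have hx' : (∑ i, u i)⁻¹ • u ∈ stdSimplex ℝ (Fin d) := by
    refine ⟨fun i => mul_nonneg (inv_nonneg.2 hσ.le) (hupos i).le, ?_⟩
    simp only [Pi.smul_apply, smul_eq_mul, ← Finset.mul_sum]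
    exact inv_mul_cancel₀ hσ.ne'
  have hfle : f ((∑ i, u i)⁻¹ • u) ≤ f x := hmax hx'
  refine absurd hfle (not_le.2 ?_)
  rw [Finset.lt_inf'_iff]
  intro i _
  simp only [Matrix.mulVec_smul, Pi.smul_apply, smul_eq_mul]
  rw [mul_div_mul_left _ _ (inv_pos.2 hσ).ne', lt_div_iff₀ (hMu i)]
  have := hstrict i
  simpa [Matrix.mulVec_sub, Matrix.mulVec_smul] using this

theorem IsOffDiagPos.exists_pos_eigenvector [NeZero d] {B : Matrix (Fin d) (Fin d) ℝ}
    (hB : IsOffDiagPos B) : ∃ (r : ℝ) (x : Fin d → ℝ), (∀ i, 0 < x i) ∧ B *ᵥ x = r • x := by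
  -- Adding `c` to the diagonal makes all entries positive and keeps the eigenvectors.
  set c : ℝ := 1 + ∑ i, |B i i| with hc
  have hci : ∀ i, 0 < B i i + c := by
    intro i
    have := Finset.single_le_sum (f := fun i => |B i i|) (fun i _ => abs_nonneg _)
      (Finset.mem_univ i)
    have := neg_abs_le (B i i)
    linarith
  obtain ⟨r, x, hx, h⟩ := exists_pos_eigenvector_of_pos (M := B + c • 1) fun i j => by
    by_cases hij : i = j
    · simpa [hij] using hci j
    · simpa [Matrix.one_apply_ne hij] using hB i j (Ne.symm hij)
  refine ⟨r - c, x, hx, ?_⟩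
  rw [Matrix.add_mulVec, Matrix.smul_mulVec, Matrix.one_mulVec] at h
  rw [sub_smul, ← h, add_sub_cancel_right]

/-! ### Complex spectrum and spectral abscissa -/

theorem mem_spectrum_iff_exists_mulVec_eq {M : Matrix (Fin d) (Fin d) ℂ} {μ : ℂ} :
    μ ∈ spectrum ℂ M ↔ ∃ z : Fin d → ℂ, z ≠ 0 ∧ M *ᵥ z = μ • z := by
  rw [spectrum.mem_iff, Matrix.isUnit_iff_isUnit_det, isUnit_iff_ne_zero, not_not,
    ← Matrix.exists_mulVec_eq_zero_iff]
  refine exists_congr fun z => and_congr_right fun _ => ?_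
  rw [Matrix.sub_mulVec, sub_eq_zero, Algebra.algebraMap_eq_smul_one, Matrix.smul_mulVec,
    Matrix.one_mulVec, eq_comm]

theorem mem_spectrum_of_mulVec_eq {A : Matrix (Fin d) (Fin d) ℝ} {x : Fin d → ℝ} {t : ℝ}
    (hx : x ≠ 0) (h : A *ᵥ x = t • x) :
    (t : ℂ) ∈ spectrum ℂ (A.map (fun x : ℝ => (x : ℂ))) := by
  rw [mem_spectrum_iff_exists_mulVec_eq]
  refine ⟨fun i => (x i : ℂ), fun h0 => hx ?_, ?_⟩
  · funext i
    simpa using congrFun h0 i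
  · funext i
    have := congrArg (fun s : ℝ => (s : ℂ)) (congrFun h i)
    simpa [Matrix.mulVec, dotProduct] using this

/-- A positive vector `x` with `A x ≤ t x` bounds the real parts of the eigenvalues by `t`. -/
theorem IsMetzler.re_le_of_mulVec_le [NeZero d] {A : Matrix (Fin d) (Fin d) ℝ} (hA : IsMetzler A)
    {x : Fin d → ℝ} {t : ℝ} (hx : ∀ i, 0 < x i) (h : ∀ i, (A *ᵥ x) i ≤ t * x i) {μ : ℂ}
    (hμ : μ ∈ spectrum ℂ (A.map (fun x : ℝ => (x : ℂ)))) : μ.re ≤ t := by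
  obtain ⟨z, hz0, hz⟩ := mem_spectrum_iff_exists_mulVec_eq.1 hμ
  -- Row `k`, where `s x` touches the moduli of `z`, gives `|μ - A k k| |z k| ≤ s ∑_{j ≠ k} A k j x
  -- j ≤ (t - A k k) |z k|`.
  obtain ⟨s, hs0, hs, k, hk⟩ := exists_touching (x := fun i => ‖z i‖) (fun i => norm_nonneg _) hx
  have hzk : 0 < ‖z k‖ := by
    rw [hk]
    refine mul_pos (lt_of_le_of_ne hs0 fun h0 => hz0 ?_) (hx k)
    funext i
    have := hs i
    rw [← h0, zero_mul] at this
    simpa using this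
  have hrow : ∑ j, (A k j : ℂ) * z j = μ * z k := by
    simpa [Matrix.mulVec, dotProduct] using congrFun hz k
  rw [← Finset.add_sum_erase _ _ (Finset.mem_univ k)] at hrow
  have hx' : A k k * x k + ∑ j ∈ Finset.univ.erase k, A k j * x j ≤ t * x k := by
    rw [Finset.add_sum_erase _ (fun j => A k j * x j) (Finset.mem_univ k)]
    exact h k
  have hdiff : (μ - A k k) * z k = ∑ j ∈ Finset.univ.erase k, (A k j : ℂ) * z j := by
    linear_combination -hrow
  have hnorm : ‖μ - A k k‖ * ‖z k‖ ≤ s * ∑ j ∈ Finset.univ.erase k, A k j * x j := by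
    rw [← norm_mul, hdiff, Finset.mul_sum]
    refine (norm_sum_le _ _).trans (Finset.sum_le_sum fun j hj => ?_)
    have hAj := hA k j (Finset.ne_of_mem_erase hj)
    rw [norm_mul, Complex.norm_real, Real.norm_of_nonneg hAj]
    have := mul_le_mul_of_nonneg_left (hs j) hAj
    linarith
  have hre : μ.re - A k k ≤ ‖μ - A k k‖ := by
    simpa using Complex.re_le_norm (μ - A k k)
  have h1 := mul_le_mul_of_nonneg_right hre hzk.le
  have h2 := mul_le_mul_of_nonneg_left hx' hs0
  have h3 : (μ.re - A k k) * ‖z k‖ ≤ (t - A k k) * ‖z k‖ := by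
    have h4 : (t - A k k) * ‖z k‖ = s * (t * x k) - s * (A k k * x k) := by rw [hk]; ring
    linarith
  have := le_of_mul_le_mul_right h3 hzk
  linarith

theorem spectralAbscissa_eq {A : Matrix (Fin d) (Fin d) ℝ} {x : Fin d → ℝ} {t : ℝ} (hx : x ≠ 0)
    (h : A *ᵥ x = t • x)
    (hle : ∀ μ ∈ spectrum ℂ (A.map (fun x : ℝ => (x : ℂ))), μ.re ≤ t) :
    spectralAbscissa A = t := by
  refine IsGreatest.csSup_eq ⟨⟨t, mem_spectrum_of_mulVec_eq hx h, rfl⟩, ?_⟩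
  rintro _ ⟨μ, hμ, rfl⟩
  exact hle μ hμ

theorem ne_zero_of_pos [NeZero d] {x : Fin d → ℝ} (hx : ∀ i, 0 < x i) : x ≠ 0 := fun h0 => by
  have := hx 0
  simp [h0] at this

theorem IsOffDiagPos.exists_isLeadingEigenvector [NeZero d] {B : Matrix (Fin d) (Fin d) ℝ}
    (hB : IsOffDiagPos B) :
    ∃ x : Fin d → ℝ, IsLeadingEigenvector B x ∧ ‖WithLp.toLp 2 x‖ = 1 := by
  obtain ⟨r, x, hx, h⟩ := hB.exists_pos_eigenvector
  have hx0 : x ≠ 0 := ne_zero_of_pos hx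
  have hr : spectralAbscissa B = r := spectralAbscissa_eq hx0 h fun μ hμ =>
    hB.isMetzler.re_le_of_mulVec_le hx (fun i => by rw [h]; rfl) hμ
  have hn : 0 < ‖WithLp.toLp 2 x‖ := by simpa using hx0
  refine ⟨‖WithLp.toLp 2 x‖⁻¹ • x, ⟨?_, fun i => ?_, ?_⟩, ?_⟩
  · exact smul_ne_zero (inv_pos.2 hn).ne' hx0
  · exact mul_nonneg (inv_pos.2 hn).le (hx i).le
  · rw [Matrix.mulVec_smul, h, hr, smul_comm]
  · rw [WithLp.toLp_smul, norm_smul, norm_inv, norm_norm, inv_mul_cancel₀ hn.ne']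

theorem IsOffDiagPos.pos_of_isLeadingEigenvector {B : Matrix (Fin d) (Fin d) ℝ}
    (hB : IsOffDiagPos B) {x : Fin d → ℝ} (hx : IsLeadingEigenvector B x) (i : Fin d) : 0 < x i :=
  hB.pos_of_mulVec_eq hx.nonneg hx.ne_zero hx.mulVec_eq i

/-! ### Polynomial form of the resolvent -/

/-- The multiplicity of a common root can be factored out of a nonzero vector of polynomials. -/
theorem exists_eq_pow_mul_eval_ne_zero {ι : Type*} [Fintype ι] {p : ι → Polynomial ℝ} (hp : p ≠ 0)
    (a : ℝ) : ∃ (m : ℕ) (q : ι → Polynomial ℝ),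
      (∀ i, p i = (Polynomial.X - Polynomial.C a) ^ m * q i) ∧ ∃ i, (q i).eval a ≠ 0 := by
  classical
  obtain ⟨i₀, hi₀⟩ := Function.ne_iff.1 hp
  -- The least multiplicity of `a` among the nonzero entries divides out of every entry and leaves
  -- the `k`-th quotient nonzero at `a`.
  obtain ⟨k, hk, hmin⟩ := Finset.exists_min_image (Finset.univ.filter fun i => p i ≠ 0)
    (fun i => (p i).rootMultiplicity a) ⟨i₀, by simpa using hi₀⟩
  have hk0 : p k ≠ 0 := by simpa using hk
  have hdvd : ∀ i, (Polynomial.X - Polynomial.C a) ^ (p k).rootMultiplicity a ∣ p i := by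
    intro i
    by_cases hi : p i = 0
    · simp [hi]
    · exact (Polynomial.le_rootMultiplicity_iff hi).1 (hmin i (by simpa using hi))
  choose q hq using hdvd
  refine ⟨_, q, hq, k, fun h0 => ?_⟩
  obtain ⟨r, hr, hndvd⟩ := Polynomial.exists_eq_pow_rootMultiplicity_mul_and_not_dvd (p k) hk0 a
  have hqr : q k = r :=
    mul_left_cancel₀ (pow_ne_zero _ (Polynomial.X_sub_C_ne_zero a)) ((hq k).symm.trans hr)
  exact hndvd (Polynomial.dvd_iff_isRoot.2 (hqr ▸ h0))

/-- The solution of `(t - A) x = 1`, for `t` near `a`, is proportional to a vector of polynomials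
in `t` without a common zero at `a`. -/
theorem exists_polynomial_resolvent [NeZero d] (A : Matrix (Fin d) (Fin d) ℝ) (a : ℝ) :
    ∃ (m : ℕ) (q : Fin d → Polynomial ℝ), (∃ i, (q i).eval a ≠ 0) ∧
      ∀ t i, (t - a) ^ m * (t * (q i).eval t - (A *ᵥ fun j => (q j).eval t) i) =
        A.charpoly.eval t := by
  -- The polynomial vector `adj(t - A) 1` solves the system up to the factor `charpoly`; it may
  -- vanish at `a`, so a power of `t - a` is then removed.
  have hp : ∀ i, ((charmatrix A) *ᵥ ((charmatrix A).adjugate *ᵥ fun _ => 1)) i = A.charpoly := by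
    intro i
    rw [Matrix.mulVec_mulVec, Matrix.mul_adjugate, Matrix.smul_mulVec, Matrix.one_mulVec]
    simp [Matrix.charpoly]
  have hp0 : (charmatrix A).adjugate *ᵥ (fun _ => (1 : Polynomial ℝ)) ≠ 0 := by
    intro h0
    have := hp 0
    rw [h0, Matrix.mulVec_zero] at this
    exact (Matrix.charpoly_monic A).ne_zero this.symm
  obtain ⟨m, q, hq, hqa⟩ := exists_eq_pow_mul_eval_ne_zero hp0 a
  refine ⟨m, q, hqa, fun t i => ?_⟩
  rw [← hp i]
  simp only [Matrix.mulVec, dotProduct, Polynomial.eval_finsetSum, Polynomial.eval_mul]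
  have hq' : ∀ j, Polynomial.eval t (∑ k, (charmatrix A).adjugate j k * 1) =
      (t - a) ^ m * (q j).eval t := by
    intro j
    have := congrArg (Polynomial.eval t) (hq j)
    simpa [Matrix.mulVec, dotProduct] using this
  have hc : ∀ j, (charmatrix A i j).eval t = (if i = j then t else 0) - A i j := by
    intro j
    by_cases hij : i = j
    · subst hij; simp
    · simp [hij]
  simp only [Polynomial.eval_finsetSum, Polynomial.eval_mul] at hq'
  simp only [hq', hc, sub_mul, Finset.sum_sub_distrib, ite_mul, zero_mul, Finset.sum_ite_eq,
    Finset.mem_univ, if_true, mul_sub, Finset.mul_sum]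
  congr 1
  · ring
  · exact Finset.sum_congr rfl fun j _ => by ring

theorem eventually_eval_ne_zero {p : Polynomial ℝ} (hp : p ≠ 0) (a : ℝ) :
    ∀ᶠ t in 𝓝[>] a, p.eval t ≠ 0 := by
  have h : (p.roots.toFinset.erase a : Set ℝ)ᶜ ∈ 𝓝 a :=
    (Finset.finite_toSet _).isClosed.compl_mem_nhds (by simp)
  filter_upwards [mem_nhdsWithin_of_mem_nhds h, self_mem_nhdsWithin] with t ht hta h0
  refine ht ?_
  simp only [Finset.coe_erase, Set.mem_sdiff, Finset.mem_coe, Multiset.mem_toFinset,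
    Set.mem_singleton_iff]
  exact ⟨(Polynomial.mem_roots hp).2 h0, (Set.mem_Ioi.1 hta).ne'⟩

/-! ### Limits of the perturbed abscissas and eigenvectors -/

theorem spectralAbscissa_add_smul_allOnes_strictMonoOn [NeZero d] {A : Matrix (Fin d) (Fin d) ℝ}
    (hA : IsMetzler A) :
    StrictMonoOn (fun ε : ℝ => spectralAbscissa (A + ε • allOnes d)) (Set.Ioi 0) := by
  intro ε hε δ hδ hεδ
  have hBε := hA.isOffDiagPos_add_smul_allOnes (Set.mem_Ioi.1 hε)
  have hBδ := hA.isOffDiagPos_add_smul_allOnes (Set.mem_Ioi.1 hδ)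
  obtain ⟨x, hx, -⟩ := hBε.exists_isLeadingEigenvector
  obtain ⟨y, hy, -⟩ := hBδ.exists_isLeadingEigenvector
  have hxpos := hBε.pos_of_isLeadingEigenvector hx
  have hsum : 0 < ∑ j, x j := Finset.sum_pos (fun i _ => hxpos i) Finset.univ_nonempty
  have hlt : ∀ i, spectralAbscissa (A + ε • allOnes d) * x i < ((A + δ • allOnes d) *ᵥ x) i := by
    intro i
    have h := congrFun hx.mulVec_eq i
    rw [add_smul_allOnes_mulVec, Pi.smul_apply, smul_eq_mul] at h
    rw [add_smul_allOnes_mulVec, ← h]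
    have := mul_lt_mul_of_pos_right hεδ hsum
    linarith
  exact hBδ.lt_of_le_mulVec hxpos (hBδ.pos_of_isLeadingEigenvector hy) hy.mulVec_eq
    (fun i => (hlt i).le) (hlt 0)

theorem mulVec_le_spectralAbscissa_mul {A : Matrix (Fin d) (Fin d) ℝ} {ε : ℝ} (hε : 0 < ε) {x : Fin d → ℝ}
    (hx : IsLeadingEigenvector (A + ε • allOnes d) x) (i : Fin d) :
    (A *ᵥ x) i ≤ spectralAbscissa (A + ε • allOnes d) * x i := by
  have h := congrFun hx.mulVec_eq i
  rw [add_smul_allOnes_mulVec, Pi.smul_apply, smul_eq_mul] at h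
  have := mul_nonneg hε.le (Finset.sum_nonneg fun j (_ : j ∈ Finset.univ) => hx.nonneg j)
  linarith

/-- The perturbed spectral abscissas converge strictly from above. -/
theorem exists_tendsto_spectralAbscissa [NeZero d] {A : Matrix (Fin d) (Fin d) ℝ}
    (hA : IsMetzler A) : ∃ a : ℝ,
      Tendsto (fun ε : ℝ => spectralAbscissa (A + ε • allOnes d)) (𝓝[>] 0) (𝓝[>] a) ∧
      ∀ ε : ℝ, 0 < ε → a < spectralAbscissa (A + ε • allOnes d) := by
  set f : ℝ → ℝ := fun ε => spectralAbscissa (A + ε • allOnes d) with hf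
  have hmono := spectralAbscissa_add_smul_allOnes_strictMonoOn hA
  have hbdd : BddBelow (f '' Set.Ioi 0) := by
    -- Row `0` of `A x ≤ t x`, with its nonnegative off-diagonal terms dropped, gives `A 0 0 ≤ t`.
    refine ⟨A 0 0, ?_⟩
    rintro _ ⟨ε, hε, rfl⟩
    have hB := hA.isOffDiagPos_add_smul_allOnes (Set.mem_Ioi.1 hε)
    obtain ⟨x, hx, -⟩ := hB.exists_isLeadingEigenvector
    have hxpos := hB.pos_of_isLeadingEigenvector hx
    refine le_of_mul_le_mul_right (le_trans ?_
      (mulVec_le_spectralAbscissa_mul (Set.mem_Ioi.1 hε) hx 0)) (hxpos 0)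
    refine le_of_le_of_eq (le_add_of_nonneg_right (Finset.sum_nonneg fun j hj => ?_))
      (Finset.add_sum_erase _ (fun j => A 0 j * x j) (Finset.mem_univ 0))
    exact mul_nonneg (hA 0 j (Finset.ne_of_mem_erase hj)) (hxpos j).le
  have hlt : ∀ ε > 0, sInf (f '' Set.Ioi 0) < f ε := fun ε hε =>
    (csInf_le hbdd ⟨ε / 2, half_pos hε, rfl⟩).trans_lt
      (hmono (half_pos hε) hε (half_lt_self hε))
  refine ⟨_, tendsto_nhdsWithin_iff.2 ⟨hmono.monotoneOn.tendsto_nhdsGT hbdd, ?_⟩, hlt⟩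
  filter_upwards [self_mem_nhdsWithin] with ε hε using hlt ε hε

/-- The perturbed normalized leading eigenvectors converge, and the limit does not depend on the
choice of them. -/
theorem exists_tendsto_leadingEigenvector [NeZero d] {A : Matrix (Fin d) (Fin d) ℝ}
    (hA : IsMetzler A) : ∃ v : Fin d → ℝ, ∀ w : ℝ → Fin d → ℝ,
      (∀ ε : ℝ, 0 < ε →
        IsLeadingEigenvector (A + ε • allOnes d) (w ε) ∧ ‖WithLp.toLp 2 (w ε)‖ = 1) →
      Tendsto w (𝓝[>] 0) (𝓝 v) := by
  obtain ⟨a, ha, hlt⟩ := exists_tendsto_spectralAbscissa hA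
  obtain ⟨m, q, ⟨k, hk⟩, hq⟩ := exists_polynomial_resolvent A a
  let Q : ℝ → Fin d → ℝ := fun t i => (q i).eval t
  have hQc : Continuous Q := continuous_pi fun i => (q i).continuous
  have hQa : Q a ≠ 0 := fun h0 => hk (congrFun h0 k)
  -- Absolute values remove the unknown sign of the scalar `c` below, as `w ε` is positive.
  let G : ℝ → Fin d → ℝ := fun t i => |Q t i| / ‖WithLp.toLp 2 (Q t)‖
  have hG : Tendsto G (𝓝[>] a) (𝓝 (G a)) := by
    refine Tendsto.mono_left ?_ nhdsWithin_le_nhds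
    refine tendsto_pi_nhds.2 fun i => ?_
    refine Tendsto.div ?_ ?_ (by simpa using hQa)
    · exact (((continuous_apply i).comp hQc).abs).tendsto a
    · exact (((PiLp.continuous_toLp 2 _).comp hQc).norm).tendsto a
  refine ⟨G a, fun w hw => (hG.comp ha).congr' ?_⟩
  filter_upwards [self_mem_nhdsWithin,
    ha.eventually (eventually_eval_ne_zero (Matrix.charpoly_monic A).ne_zero a)] with ε hε hχ
  have hε' : 0 < ε := hε
  obtain ⟨hwl, hw1⟩ := hw ε hε'
  set t := spectralAbscissa (A + ε • allOnes d) with ht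
  have hwpos := (hA.isOffDiagPos_add_smul_allOnes hε').pos_of_isLeadingEigenvector hwl
  have hsum : 0 < ∑ j, w ε j := Finset.sum_pos (fun i _ => hwpos i) Finset.univ_nonempty
  have hta : (t - a) ^ m ≠ 0 := pow_ne_zero _ (sub_pos.2 (hlt ε hε')).ne'
  -- The ratio of the right-hand sides of the systems satisfied by `Q t` and `w ε`. As `t` is not an
  -- eigenvalue of `A`, solutions are unique and `Q t = c • w ε`.
  set c : ℝ := A.charpoly.eval t / ((t - a) ^ m * (ε * ∑ j, w ε j)) with hc
  have hc0 : c ≠ 0 := div_ne_zero hχ (mul_ne_zero hta (mul_pos hε' hsum).ne')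
  have hQw : Q t = c • w ε := by
    have hdet : (Matrix.scalar (Fin d) t - A).det ≠ 0 := by
      rwa [← Matrix.eval_charpoly]
    rw [← sub_eq_zero]
    refine Matrix.eq_zero_of_mulVec_eq_zero hdet ?_
    funext i
    have h1 := hq t i
    have h2 := congrFun hwl.mulVec_eq i
    rw [add_smul_allOnes_mulVec, Pi.smul_apply, smul_eq_mul, ← ht] at h2
    have h3 : t * Q t i - (A *ᵥ Q t) i = c * (ε * ∑ j, w ε j) := by
      rw [hc, ← h1]
      field_simp
      rfl
    simp only [Matrix.sub_mulVec, Matrix.mulVec_sub, Matrix.mulVec_smul, Matrix.scalar_apply,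
      Matrix.mulVec_diagonal, Pi.sub_apply, Pi.smul_apply, smul_eq_mul, Pi.zero_apply]
    linear_combination h3 + c * h2
  funext i
  simp only [Function.comp, G]
  rw [hQw, WithLp.toLp_smul, norm_smul, hw1, mul_one, Real.norm_eq_abs, Pi.smul_apply, smul_eq_mul,
    abs_mul, abs_of_pos (hwpos i), mul_div_cancel_left₀ _ (abs_pos.2 hc0).ne']

theorem exists_perturbed_leadingEigenvectors [NeZero d] {A : Matrix (Fin d) (Fin d) ℝ}
    (hA : IsMetzler A) : ∃ w : ℝ → Fin d → ℝ, ∀ ε : ℝ, 0 < ε →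
      IsLeadingEigenvector (A + ε • allOnes d) (w ε) ∧ ‖WithLp.toLp 2 (w ε)‖ = 1 := by
  have h : ∀ ε : ℝ, ∃ x : Fin d → ℝ, 0 < ε →
      IsLeadingEigenvector (A + ε • allOnes d) x ∧ ‖WithLp.toLp 2 x‖ = 1 := by
    intro ε
    by_cases hε : 0 < ε
    · obtain ⟨x, hx⟩ := (hA.isOffDiagPos_add_smul_allOnes hε).exists_isLeadingEigenvector
      exact ⟨x, fun _ => hx⟩
    · exact ⟨0, fun h => absurd h hε⟩
  choose w hw using h
  exact ⟨w, hw⟩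

theorem IsMetzler.existsUnique_isSelectedLeadingEigenvector [NeZero d]
    {A : Matrix (Fin d) (Fin d) ℝ} (hA : IsMetzler A) :
    ∃! v : Fin d → ℝ, IsSelectedLeadingEigenvector A v := by
  obtain ⟨v, hv⟩ := exists_tendsto_leadingEigenvector hA
  obtain ⟨w, hw⟩ := exists_perturbed_leadingEigenvectors hA
  refine ⟨v, ⟨w, hw, hv w hw⟩, ?_⟩
  rintro v' ⟨w', hw', hlim⟩
  exact tendsto_nhds_unique hlim (hv w' hw')

/-- The eigenvector equation passes to the limit with eigenvalue `a`. This is the abscissa of `A`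
because every perturbed abscissa already bounds the real parts of the spectrum of `A`. -/
theorem IsSelectedLeadingEigenvector.isLeadingEigenvector [NeZero d]
    {A : Matrix (Fin d) (Fin d) ℝ} (hA : IsMetzler A) {v : Fin d → ℝ}
    (hv : IsSelectedLeadingEigenvector A v) : IsLeadingEigenvector A v := by
  obtain ⟨w, hw, hlim⟩ := hv
  obtain ⟨a, ha, hlt⟩ := exists_tendsto_spectralAbscissa hA
  have ha' := ha.mono_right nhdsWithin_le_nhds
  have hnorm : ‖WithLp.toLp 2 v‖ = 1 := by
    have h1 : Tendsto (fun ε => ‖WithLp.toLp 2 (w ε)‖) (𝓝[>] 0) (𝓝 ‖WithLp.toLp 2 v‖) :=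
      ((PiLp.continuous_toLp 2 _).norm.tendsto v).comp hlim
    refine tendsto_nhds_unique (h1.congr' ?_) tendsto_const_nhds
    filter_upwards [self_mem_nhdsWithin] with ε hε using (hw ε hε).2
  have hv0 : v ≠ 0 := by
    rintro rfl
    simp at hnorm
  have hnn : ∀ i, 0 ≤ v i := fun i => by
    refine ge_of_tendsto (((continuous_apply i).tendsto v).comp hlim) ?_
    filter_upwards [self_mem_nhdsWithin] with ε hε using (hw ε hε).1.nonneg i
  have hcont : Tendsto (fun ε : ℝ => (A + ε • allOnes d) *ᵥ w ε) (𝓝[>] 0) (𝓝 (A *ᵥ v)) := by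
    have hid : Tendsto (fun ε : ℝ => ε) (𝓝[>] 0) (𝓝 0) := tendsto_id.mono_left nhdsWithin_le_nhds
    have hc : Continuous fun y : ℝ × (Fin d → ℝ) => (A + y.1 • allOnes d) *ᵥ y.2 :=
      Continuous.matrix_mulVec (by fun_prop) (by fun_prop)
    have h0 := (hc.tendsto (0, v)).comp (hid.prodMk_nhds hlim)
    simp only [zero_smul, add_zero] at h0
    exact h0
  have heq : A *ᵥ v = a • v := by
    refine tendsto_nhds_unique hcont ((ha'.smul hlim).congr' ?_)
    filter_upwards [self_mem_nhdsWithin] with ε hε using (hw ε hε).1.mulVec_eq.symm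
  refine ⟨hv0, hnn, ?_⟩
  rw [spectralAbscissa_eq hv0 heq, heq]
  intro μ hμ
  refine ge_of_tendsto ha' ?_
  filter_upwards [self_mem_nhdsWithin] with ε hε
  exact hA.re_le_of_mulVec_le ((hA.isOffDiagPos_add_smul_allOnes hε).pos_of_isLeadingEigenvector
    (hw ε hε).1) (mulVec_le_spectralAbscissa_mul hε (hw ε hε).1) hμ

/-! ### Strict monotonicity of one step under perturbation -/

theorem eventually_dotProduct_lt {l : Filter ℝ} {w : ℝ → Fin d → ℝ} {v a b : Fin d → ℝ}
    (hw : Tendsto w l (𝓝 v)) (h : a ⬝ᵥ v < b ⬝ᵥ v) : ∀ᶠ ε in l, a ⬝ᵥ w ε < b ⬝ᵥ w ε := by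
  have hc : ∀ c : Fin d → ℝ, Tendsto (fun ε => c ⬝ᵥ w ε) l (𝓝 (c ⬝ᵥ v)) := fun c =>
    ((Continuous.dotProduct continuous_const continuous_id).tendsto v).comp hw
  exact (hc a).eventually_lt (hc b) h

theorem dotProduct_eq_mulVec (A : Matrix (Fin d) (Fin d) ℝ) (x : Fin d → ℝ) (i : Fin d) :
    A i ⬝ᵥ x = (A *ᵥ x) i := rfl

theorem IsMetzlerProductFamily.isMetzler {F : Fin d → Set (Fin d → ℝ)}
    (hF : IsMetzlerProductFamily F) {A : Matrix (Fin d) (Fin d) ℝ} (hA : A ∈ productFamily F) :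
    IsMetzler A := fun i j hj => hF.subset_metzlerRows i (hA i) j hj

/-- Replacing rows by rows that are strictly better for the selected leading eigenvector increases
the spectral abscissas of all sufficiently small perturbations. -/
theorem eventually_spectralAbscissa_lt [NeZero d] {A A' : Matrix (Fin d) (Fin d) ℝ}
    (hA : IsMetzler A) (hA' : IsMetzler A') {v : Fin d → ℝ}
    (hv : IsSelectedLeadingEigenvector A v) (hne : A' ≠ A)
    (h : ∀ i, A' i = A i ∨ A i ⬝ᵥ v < A' i ⬝ᵥ v) :
    ∀ᶠ ε in 𝓝[>] (0 : ℝ),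
      spectralAbscissa (A + ε • allOnes d) < spectralAbscissa (A' + ε • allOnes d) := by
  obtain ⟨w, hw, hlim⟩ := hv
  have hev : ∀ᶠ ε in 𝓝[>] (0 : ℝ), ∀ i, A' i = A i ∨ A i ⬝ᵥ w ε < A' i ⬝ᵥ w ε := by
    refine eventually_all.2 fun i => ?_
    rcases h i with h | h
    · exact Eventually.of_forall fun _ => Or.inl h
    · exact (eventually_dotProduct_lt hlim h).mono fun _ => Or.inr
  obtain ⟨i, hi⟩ := Function.ne_iff.1 hne
  filter_upwards [hev, self_mem_nhdsWithin] with ε hε hε0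
  have hB := hA.isOffDiagPos_add_smul_allOnes (Set.mem_Ioi.1 hε0)
  have hB' := hA'.isOffDiagPos_add_smul_allOnes (Set.mem_Ioi.1 hε0)
  have hwl := (hw ε hε0).1
  obtain ⟨y, hy, -⟩ := hB'.exists_isLeadingEigenvector
  have heq := fun j => congrFun hwl.mulVec_eq j
  simp only [add_smul_allOnes_mulVec, Pi.smul_apply, smul_eq_mul] at heq
  refine hB'.lt_of_le_mulVec (hB.pos_of_isLeadingEigenvector hwl)
    (hB'.pos_of_isLeadingEigenvector hy) hy.mulVec_eq (fun j => ?_) (i := i) ?_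
  -- The term `ε ∑ w` is common to both matrices, so only the rows of `A` and `A'` are compared.
  · rw [add_smul_allOnes_mulVec, ← heq, ← dotProduct_eq_mulVec, ← dotProduct_eq_mulVec]
    rcases hε j with h | h
    · rw [h]
    · linarith
  · rw [add_smul_allOnes_mulVec, ← heq, ← dotProduct_eq_mulVec, ← dotProduct_eq_mulVec]
    have := (hε i).resolve_left hi
    linarith

theorem eventually_spectralAbscissa_gt [NeZero d] {A A' : Matrix (Fin d) (Fin d) ℝ}
    (hA : IsMetzler A) (hA' : IsMetzler A') {v : Fin d → ℝ}
    (hv : IsSelectedLeadingEigenvector A v) (hne : A' ≠ A)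
    (h : ∀ i, A' i = A i ∨ A' i ⬝ᵥ v < A i ⬝ᵥ v) :
    ∀ᶠ ε in 𝓝[>] (0 : ℝ),
      spectralAbscissa (A' + ε • allOnes d) < spectralAbscissa (A + ε • allOnes d) := by
  obtain ⟨w, hw, hlim⟩ := hv
  have hev : ∀ᶠ ε in 𝓝[>] (0 : ℝ), ∀ i, A' i = A i ∨ A' i ⬝ᵥ w ε < A i ⬝ᵥ w ε := by
    refine eventually_all.2 fun i => ?_
    rcases h i with h | h
    · exact Eventually.of_forall fun _ => Or.inl h
    · exact (eventually_dotProduct_lt hlim h).mono fun _ => Or.inr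
  obtain ⟨i, hi⟩ := Function.ne_iff.1 hne
  filter_upwards [hev, self_mem_nhdsWithin] with ε hε hε0
  have hB := hA.isOffDiagPos_add_smul_allOnes (Set.mem_Ioi.1 hε0)
  have hB' := hA'.isOffDiagPos_add_smul_allOnes (Set.mem_Ioi.1 hε0)
  have hwl := (hw ε hε0).1
  obtain ⟨y, hy, -⟩ := hB'.exists_isLeadingEigenvector
  have heq := fun j => congrFun hwl.mulVec_eq j
  simp only [add_smul_allOnes_mulVec, Pi.smul_apply, smul_eq_mul] at heq
  refine hB'.gt_of_mulVec_le (hB.pos_of_isLeadingEigenvector hwl)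
    (hB'.pos_of_isLeadingEigenvector hy) hy.mulVec_eq (fun j => ?_) (i := i) ?_
  · rw [add_smul_allOnes_mulVec, ← heq, ← dotProduct_eq_mulVec, ← dotProduct_eq_mulVec]
    rcases hε j with h | h
    · rw [h]
    · linarith
  · rw [add_smul_allOnes_mulVec, ← heq, ← dotProduct_eq_mulVec, ← dotProduct_eq_mulVec]
    have := (hε i).resolve_left hi
    linarith

/-! ### Greedy steps and absence of cycles -/

/-- Rows that tie are kept; a tie at `v` could break either way at `w ε`, whereas a strict gain
survives. -/
theorem MaxStep.row {F : Fin d → Set (Fin d → ℝ)} {v : Fin d → ℝ}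
    {A A' : Matrix (Fin d) (Fin d) ℝ} (h : MaxStep F v A A') (hA : A ∈ productFamily F)
    (i : Fin d) : A' i ∈ F i ∧ (A' i = A i ∨ A i ⬝ᵥ v < A' i ⬝ᵥ v) := by
  obtain ⟨B, hB⟩ := h
  obtain ⟨⟨hmem, hmax⟩, heq, hlt⟩ := hB i
  rcases (hmax (A i) (hA i)).lt_or_eq with h | h
  · rw [hlt h]
    exact ⟨hmem, Or.inr h⟩
  · rw [heq h.symm]
    exact ⟨hA i, Or.inl rfl⟩

theorem MinStep.row {F : Fin d → Set (Fin d → ℝ)} {v : Fin d → ℝ}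
    {A A' : Matrix (Fin d) (Fin d) ℝ} (h : MinStep F v A A') (hA : A ∈ productFamily F)
    (i : Fin d) : A' i ∈ F i ∧ (A' i = A i ∨ A' i ⬝ᵥ v < A i ⬝ᵥ v) := by
  obtain ⟨B, hB⟩ := h
  obtain ⟨⟨hmem, hmin⟩, heq, hlt⟩ := hB i
  rcases (hmin (A i) (hA i)).lt_or_eq with h | h
  · rw [hlt h]
    exact ⟨hmem, Or.inr h⟩
  · rw [heq h]
    exact ⟨hA i, Or.inl rfl⟩

/-- A sequence has distinct terms if, in the limit along a filter, some function increases strictly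
along it with respect to a transitive irreflexive relation. -/
theorem ne_of_eventually_rel_succ {α β γ : Type*} (r : γ → γ → Prop) [IsTrans γ r] [Std.Irrefl r]
    {l : Filter β} [l.NeBot] (f : β → α → γ) {A : ℕ → α} {N : ℕ}
    (h : ∀ k < N, ∀ᶠ ε in l, r (f ε (A k)) (f ε (A (k + 1)))) {k m : ℕ} (hkm : k < m)
    (hm : m ≤ N) : A k ≠ A m := by
  have hev : ∀ᶠ ε in l, r (f ε (A k)) (f ε (A m)) := by
    induction m, hkm using Nat.le_induction with
    | base => exact h k hm
    | succ n hn ih =>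
      -- Only finitely many eventual conditions are intersected, so a single `ε` serves the whole
      -- chain.
      filter_upwards [ih (by omega), h n hm] with ε h1 h2 using _root_.trans h1 h2
  intro heq
  obtain ⟨ε, hε⟩ := hev.exists
  rw [heq] at hε
  exact irrefl _ hε

theorem IsSelectiveGreedyMaxRun.ne [NeZero d] {F : Fin d → Set (Fin d → ℝ)}
    (hF : IsMetzlerProductFamily F) {N : ℕ} {A : ℕ → Matrix (Fin d) (Fin d) ℝ}
    {v : ℕ → Fin d → ℝ} (h : IsSelectiveGreedyMaxRun F N A v) {k m : ℕ} (hkm : k < m)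
    (hm : m ≤ N) : A k ≠ A m := by
  have hmem : ∀ n ≤ N, A n ∈ productFamily F := by
    intro n
    induction n with
    | zero => exact fun _ => h.start
    | succ n ih => exact fun hn i => ((h.step n hn).row (ih (Nat.le_of_lt hn)) i).1
  refine ne_of_eventually_rel_succ (l := 𝓝[>] (0 : ℝ)) (· < ·)
    (fun ε B => spectralAbscissa (B + ε • allOnes d)) (fun n hn => ?_) hkm hm
  exact eventually_spectralAbscissa_lt (hF.isMetzler (hmem n hn.le)) (hF.isMetzler (hmem _ hn))
    (h.selected n hn) (h.not_terminated n hn) fun i => ((h.step n hn).row (hmem n hn.le) i).2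

theorem IsSelectiveGreedyMinRun.ne [NeZero d] {F : Fin d → Set (Fin d → ℝ)}
    (hF : IsMetzlerProductFamily F) {N : ℕ} {A : ℕ → Matrix (Fin d) (Fin d) ℝ}
    {v : ℕ → Fin d → ℝ} (h : IsSelectiveGreedyMinRun F N A v) {k m : ℕ} (hkm : k < m)
    (hm : m ≤ N) : A k ≠ A m := by
  have hmem : ∀ n ≤ N, A n ∈ productFamily F := by
    intro n
    induction n with
    | zero => exact fun _ => h.start
    | succ n ih => exact fun hn i => ((h.step n hn).row (ih (Nat.le_of_lt hn)) i).1
  refine ne_of_eventually_rel_succ (l := 𝓝[>] (0 : ℝ)) (· > ·)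
    (fun ε B => spectralAbscissa (B + ε • allOnes d)) (fun n hn => ?_) hkm hm
  exact eventually_spectralAbscissa_gt (hF.isMetzler (hmem n hn.le)) (hF.isMetzler (hmem _ hn))
    (h.selected n hn) (h.not_terminated n hn) fun i => ((h.step n hn).row (hmem n hn.le) i).2

end SelectiveGreedy

end

theorem mainTheorem7 {d : ℕ} (hd : 0 < d) :
    -- the selected leading eigenvector of a Metzler matrix is well defined, and it is a leading one
    (∀ A : Matrix (Fin d) (Fin d) ℝ, SelectiveGreedy.IsMetzler A →
      (∃! v : Fin d → ℝ, SelectiveGreedy.IsSelectedLeadingEigenvector A v) ∧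
        ∀ v : Fin d → ℝ, SelectiveGreedy.IsSelectedLeadingEigenvector A v →
          SelectiveGreedy.IsLeadingEigenvector A v) ∧
    -- the method does not cycle: before it terminates, no matrix occurs twice
    (∀ F : Fin d → Set (Fin d → ℝ), SelectiveGreedy.IsMetzlerProductFamily F →
      ∀ (N : ℕ) (A : ℕ → Matrix (Fin d) (Fin d) ℝ) (v : ℕ → Fin d → ℝ),
        (SelectiveGreedy.IsSelectiveGreedyMaxRun F N A v ∨
          SelectiveGreedy.IsSelectiveGreedyMinRun F N A v) →
        ∀ k l : ℕ, k < l → l ≤ N → A k ≠ A l) := by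
  have : NeZero d := ⟨hd.ne'⟩
  refine ⟨fun A hA => ⟨hA.existsUnique_isSelectedLeadingEigenvector,
    fun v hv => hv.isLeadingEigenvector hA⟩, ?_⟩
  rintro F hF N A v (h | h) k l hkl hl
  · exact h.ne hF hkl hl
  · exact h.ne hF hkl hl
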